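/- Let $G$ be a finite group and let $\mathcal{S}et^G$ be the category of finite $G$-sets and equivariant maps. For a map $g\colon S\to T$ of finite $G$-sets, let the dependent product $\Pi_g\colon \mathcal{S}et^G_{/S}\to \mathcal{S}et^G_{/T}$ be the right adjoint of the pullback functor $g^*\colon \mathcal{S}et^G_{/T}\to \mathcal{S}et^G_{/S}$. The category of polynomials $\mathcal{P}^G$ has the finite $G$-sets as objects, and a morphism $S\to T$ is an isomorphism class of polynomials (bispans) $S\xleftarrow{f}U_1\xrightarrow{g}U_2\xrightarrow{h}T$, where an isomorphism of polynomials is a pair of isomorphisms $U_1\cong U_1'$, $U_2\cong U_2'$ compatible with all the maps; $g$ is called the norm map and $h$ the transfer map. The composite of $S\xleftarrow{f}A\xrightarrow{g}B\xrightarrow{h}T$ followed by $T\xleftarrow{r}C\xrightarrow{q}D\xrightarrow{t}U$ is represented by $$S\leftarrow A\times_B (E\times_D C)\to E\to U,$$ where $E=\Pi_q(C\times_T B\to C)$, the map $E\times_D C\to B$ is the counit $E\times_D C\to C\times_T B$ of the adjunction $q^*\dashv\Pi_q$ followed by the projection to $B$, the first map is the projection to $A$ followed by $f$, the second is the projection to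 $E$, and the third is $E\to D$ followed by $t$. The identity of $S$ is represented by $S=S=S=S$. An indexing category is a wide, pullback stable, finite coproduct complete subcategory $\mathcal{O}$ of $\mathcal{S}et^G$ (that is, $\mathcal{O}$ has finite coproducts and the inclusion into $\mathcal{S}et^G$ preserves them). A pair $(\mathcal{O}_a,\mathcal{O}_m)$ of indexing categories is compatible if for every map $g\colon S\to T$ in $\mathcal{O}_m$ and every map $X\to S$ in $\mathcal{O}_a$, the map $\Pi_g(X)\to T$ is in $\mathcal{O}_a$. Let $\mathcal{P}^G_{\mathcal{O}_a,\mathcal{O}_m}$ be the wide subgraph of $\mathcal{P}^G$ whose arrows are the isomorphism classes containing a polynomial $S\leftarrow U_1\xrightarrow{g}U_2\xrightarrow{h}T$ with $g\in\mathcal{O}_m$ and $h\in\mathcal{O}_a$. **Theorem.** If $(\mathcal{O}_a,\mathcal{O}_m)$ is a compatible pair of indexing categories, then $\mathcal{P}^G_{\mathcal{O}_a,\mathcal{O}_m}$ is a subcategory of $\mathcal{P}^G$: it contains all identities and is closed under composition. Moreover, the class of a polynomial $S\leftarrow U_1\xrightarrow{g}U_2\xrightarrow{h}T$ lies in $\mathcal{P}^G_{\mathcal{O}_a,\mathcal{O}_m}$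 if and only if $g\in\mathcal{O}_m$ and $h\in\mathcal{O}_a$. -/

import Mathlib

open CategoryTheory Limits
universe u v

/-- The category of finite `G`-sets and equivariant maps. -/
abbrev FinGSet (G : Type v) [Group G] := Action FintypeCat.{u} G

namespace FinGSet

section Elements

variable {G : Type v} [Group G]

lemma act_map {X Y : FinGSet.{u} G} (f : X ⟶ Y) (a : G) (x : X.V) :
    f (a • x : X.V) = (a • f x : Y.V) :=
  ConcreteCategory.congr_hom (f.comm a) x

lemma hom_ext_apply {X Y : FinGSet.{u} G} {f f' : X ⟶ Y}
    (h : ∀ x : X.V, f x = f' x) : f = f' :=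
  ConcreteCategory.hom_ext _ _ h

lemma comp_app {X Y Z : FinGSet.{u} G} (f : X ⟶ Y) (g : Y ⟶ Z) (x : X.V) :
    (f ≫ g) x = g (f x) := rfl

/-- The finite `G`-set on a finite type with a `G`-action. -/
def ofAct (α : Type u) [Finite α] [MulAction G α] : FinGSet.{u} G :=
  letI : MulAction G (FintypeCat.of α) := inferInstanceAs (MulAction G α)
  Action.FintypeCat.ofMulAction G (FintypeCat.of α)

/-- An equivariant function as a morphism of finite `G`-sets. -/
def mkHom {X Y : FinGSet.{u} G} (f : X.V → Y.V)
    (hf : ∀ (a : G) (x : X.V), f (a • x : X.V) = (a • f x : Y.V)) : X ⟶ Y where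
  hom := FintypeCat.homMk f
  comm a := by
    apply ConcreteCategory.hom_ext
    intro x
    exact hf a x

@[simp] lemma mkHom_apply {X Y : FinGSet.{u} G} (f : X.V → Y.V)
    (hf : ∀ (a : G) (x : X.V), f (a • x : X.V) = (a • f x : Y.V)) (x : X.V) :
    mkHom f hf x = f x := rfl

/-- An equivariant one-to-one correspondence is the graph of an isomorphism. -/
lemma exists_iso {X Y : FinGSet.{u} G} (r : X.V → Y.V → Prop)
    (hr : ∀ (a : G) (x : X.V) (y : Y.V), r x y → r (a • x : X.V) (a • y : Y.V))
    (h₁ : ∀ x, ∃ y, r x y) (h₂ : ∀ y, ∃ x, r x y)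
    (h₃ : ∀ x y y', r x y → r x y' → y = y') (h₄ : ∀ x x' y, r x y → r x' y → x = x') :
    ∃ e : X ≅ Y, ∀ x : X.V, r x (e.hom x) := by
  choose F hF using h₁
  choose F' hF' using h₂
  refine ⟨⟨mkHom F fun a x => h₃ _ _ _ (hF _) (hr a _ _ (hF x)),
    mkHom F' fun a y => h₄ _ _ _ (hF' _) (hr a _ _ (hF' y)), ?_, ?_⟩, fun x => hF x⟩
  · exact hom_ext_apply fun x => h₄ _ _ _ (hF' _) (hF x)
  · exact hom_ext_apply fun y => h₃ _ _ _ (hF _) (hF' y)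

lemma pullback_ext {X Y Z : FinGSet.{u} G} {f : X ⟶ Z} {g : Y ⟶ Z} {p p' : (pullback f g).V}
    (h₁ : pullback.fst f g p = pullback.fst f g p')
    (h₂ : pullback.snd f g p = pullback.snd f g p') : p = p' := by
  obtain ⟨x, y, h, rfl⟩ := Concrete.pullbackMk_surjective f g p
  obtain ⟨x', y', h', rfl⟩ := Concrete.pullbackMk_surjective f g p'
  rw [Concrete.pullbackMk_fst, Concrete.pullbackMk_fst] at h₁
  rw [Concrete.pullbackMk_snd, Concrete.pullbackMk_snd] at h₂
  subst h₁ h₂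
  rfl

lemma pullback_exists {X Y Z : FinGSet.{u} G} (f : X ⟶ Z) (g : Y ⟶ Z) (x : X.V) (y : Y.V)
    (h : f x = g y) : ∃ p : (pullback f g).V, pullback.fst f g p = x ∧ pullback.snd f g p = y :=
  ⟨Concrete.pullbackMk f g x y h, Concrete.pullbackMk_fst .., Concrete.pullbackMk_snd ..⟩

/-- The point of a pullback with given coordinates. -/
noncomputable def pullbackPt {X Y Z : FinGSet.{u} G} (f : X ⟶ Z) (g : Y ⟶ Z) (x : X.V) (y : Y.V)
    (h : f x = g y) : (pullback f g).V :=
  (pullback_exists f g x y h).choose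

lemma fst_pullbackPt {X Y Z : FinGSet.{u} G} (f : X ⟶ Z) (g : Y ⟶ Z) (x : X.V) (y : Y.V)
    (h : f x = g y) : pullback.fst f g (pullbackPt f g x y h) = x :=
  (pullback_exists f g x y h).choose_spec.1

lemma snd_pullbackPt {X Y Z : FinGSet.{u} G} (f : X ⟶ Z) (g : Y ⟶ Z) (x : X.V) (y : Y.V)
    (h : f x = g y) : pullback.snd f g (pullbackPt f g x y h) = y :=
  (pullback_exists f g x y h).choose_spec.2

lemma pullback_condition_apply {X Y Z : FinGSet.{u} G} (f : X ⟶ Z) (g : Y ⟶ Z)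
    (p : (pullback f g).V) : f (pullback.fst f g p) = g (pullback.snd f g p) :=
  ConcreteCategory.congr_hom (pullback.condition (f := f) (g := g)) p

end Elements

section DependentProduct

variable {G : Type v} [Group G] {S T : FinGSet.{u} G}

/-- Pairs of a point `t` of `T` and a section of `X → S` over the fibre of `g` at `t`. -/
structure FibreSection (g : S ⟶ T) (X : Over S) where
  pt : T.V
  sec : {s : S.V // g s = pt} → X.left.V
  spec : ∀ s, X.hom (sec s) = s.1

namespace FibreSection

variable {g : S ⟶ T} {X : Over S}

lemma ext_apply {σ τ : FibreSection g X} (h : σ.pt = τ.pt)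
    (h' : ∀ s hs hs', σ.sec ⟨s, hs⟩ = τ.sec ⟨s, hs'⟩) : σ = τ := by
  obtain ⟨t, σ, hσ⟩ := σ
  obtain ⟨t', τ, hτ⟩ := τ
  obtain rfl : t = t' := h
  obtain rfl : σ = τ := funext fun s => h' s.1 s.2 s.2
  rfl

instance : Finite (FibreSection g X) := by
  let F : FibreSection g X → Σ t : T.V, ({s : S.V // g s = t} → X.left.V) :=
    fun σ => ⟨σ.pt, σ.sec⟩
  refine Finite.of_injective F ?_
  rintro ⟨t, σ, hσ⟩ ⟨t', σ', hσ'⟩ h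
  obtain ⟨rfl, h⟩ := Sigma.mk.inj h
  obtain rfl := eq_of_heq h
  rfl

instance : MulAction G (FibreSection g X) where
  smul a σ :=
    { pt := a • σ.pt
      sec s := a • σ.sec ⟨a⁻¹ • s.1, by rw [act_map, s.2, inv_smul_smul]⟩
      spec s := by rw [act_map, σ.spec, smul_inv_smul] }
  one_smul σ := by
    refine ext_apply (one_smul G σ.pt) fun s hs hs' => ?_
    change (1 : G) • σ.sec ⟨(1 : G)⁻¹ • s, _⟩ = _
    simp only [inv_one, one_smul]
  mul_smul a b σ := by
    refine ext_apply (mul_smul a b σ.pt) fun s hs hs' => ?_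
    change (a * b) • σ.sec ⟨(a * b)⁻¹ • s, _⟩ = a • b • σ.sec ⟨b⁻¹ • a⁻¹ • s, _⟩
    simp only [mul_inv_rev, mul_smul]

lemma smul_pt (a : G) (σ : FibreSection g X) : (a • σ).pt = (a • σ.pt : T.V) := rfl

lemma smul_sec (a : G) (σ : FibreSection g X) (s : S.V) (hs : g s = σ.pt) (hs') :
    (a • σ).sec ⟨(a • s : S.V), hs'⟩ = (a • σ.sec ⟨s, hs⟩ : X.left.V) := by
  change a • σ.sec ⟨a⁻¹ • a • s, _⟩ = _
  simp only [inv_smul_smul]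

variable (g X) in
/-- The `G`-set of sections over fibres, as an object over `T`. -/
def toOver : Over T :=
  Over.mk (mkHom (X := ofAct (FibreSection g X)) (Y := T) FibreSection.pt fun _ _ => rfl)

lemma sec_congr {σ τ : FibreSection g X} (h : σ = τ) {s s' : S.V} (hs : s = s') (h₁ h₂) :
    σ.sec ⟨s, h₁⟩ = τ.sec ⟨s', h₂⟩ := by
  subst h hs
  rfl

variable (g X) in
/-- Evaluation of sections. -/
noncomputable def ev : (Over.pullback g).obj (toOver g X) ⟶ X :=
  Over.homMk (mkHom
    (fun p : (pullback (toOver g X).hom g).V =>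
      (pullback.fst (toOver g X).hom g p : FibreSection g X).sec
        ⟨pullback.snd (toOver g X).hom g p, (pullback_condition_apply _ _ p).symm⟩)
    (by
      intro a p
      refine (sec_congr (act_map _ a p) (act_map _ a p) _ ?_).trans
        (smul_sec a (pullback.fst (toOver g X).hom g p : FibreSection g X) _ _ _)
      rw [← act_map (pullback.snd (toOver g X).hom g) a p]
      exact (pullback_condition_apply (toOver g X).hom g (a • p)).symm.trans
        (congrArg (toOver g X).hom (act_map _ a p))))
    (hom_ext_apply fun p =>
      (pullback.fst (toOver g X).hom g p : FibreSection g X).spec _)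

lemma ev_apply (p : (pullback (toOver g X).hom g).V) (σ : FibreSection g X) (s : S.V)
    (h₁ : pullback.fst (toOver g X).hom g p = σ) (h₂ : pullback.snd (toOver g X).hom g p = s)
    (h : g s = σ.pt) :
    (ev g X).left p = σ.sec ⟨s, h⟩ := by
  subst h₁ h₂
  rfl

/-- Evaluation of an arbitrary object over `T` with a map from its pullback. -/
noncomputable def evalAt {E : Over T} (ε : (Over.pullback g).obj E ⟶ X) (e : E.left.V) (s : S.V)
    (h : g s = E.hom e) : X.left.V :=
  ε.left (pullbackPt E.hom g e s h.symm)

lemma apply_eq_evalAt {E : Over T} (ε : (Over.pullback g).obj E ⟶ X)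
    (p : (pullback E.hom g).V) (e : E.left.V) (s : S.V)
    (h₁ : pullback.fst E.hom g p = e) (h₂ : pullback.snd E.hom g p = s) (h : g s = E.hom e) :
    ε.left p = evalAt ε e s h :=
  congrArg ε.left (pullback_ext (h₁.trans (fst_pullbackPt ..).symm)
    (h₂.trans (snd_pullbackPt ..).symm))

lemma hom_evalAt {E : Over T} (ε : (Over.pullback g).obj E ⟶ X) (e : E.left.V) (s : S.V)
    (h : g s = E.hom e) : X.hom (evalAt ε e s h) = s :=
  (ConcreteCategory.congr_hom (Over.w ε) _).trans (snd_pullbackPt E.hom g e s h.symm)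

lemma evalAt_smul {E : Over T} (ε : (Over.pullback g).obj E ⟶ X) (a : G) (e : E.left.V) (s : S.V)
    (h : g s = E.hom e) (h') :
    evalAt ε (a • e) (a • s) h' = (a • evalAt ε e s h : X.left.V) := by
  refine Eq.trans ?_ (act_map ε.left a (pullbackPt E.hom g e s h.symm))
  refine (apply_eq_evalAt ε _ _ _ ?_ ?_ _).symm
  · exact (act_map _ _ _).trans (congrArg _ (fst_pullbackPt ..))
  · exact (act_map _ _ _).trans (congrArg _ (snd_pullbackPt ..))

/-- The map into the `G`-set of sections determined by a map from a pullback. -/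
noncomputable def lift {E : Over T} (ε : (Over.pullback g).obj E ⟶ X) : E ⟶ toOver g X :=
  Over.homMk (mkHom (Y := ofAct (FibreSection g X))
    (fun e => (⟨E.hom e, fun s => evalAt ε e s.1 s.2, fun s => hom_evalAt ..⟩ : FibreSection g X))
    (by
      intro a e
      refine ext_apply (act_map E.hom a e) fun s hs hs' => ?_
      obtain ⟨s, rfl⟩ : ∃ s' : S.V, s = a • s' := ⟨a⁻¹ • s, (smul_inv_smul a s).symm⟩
      have h : g s = E.hom e := by
        have h := hs
        dsimp only at h
        rwa [act_map, act_map, smul_left_cancel_iff] at h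
      exact (evalAt_smul ε a e s h hs).trans (smul_sec a (⟨E.hom e, fun s => evalAt ε e s.1 s.2, fun s => hom_evalAt ..⟩ : FibreSection g X) s h hs').symm))
    (hom_ext_apply fun e => rfl)

lemma pullback_map_fst {E E' : Over T} (m : E ⟶ E') (p : (pullback E.hom g).V) :
    pullback.fst E'.hom g (((Over.pullback g).map m).left p) = m.left (pullback.fst E.hom g p) :=
  ConcreteCategory.congr_hom (pullback.lift_fst (f := E'.hom) (g := g)
    (pullback.fst E.hom g ≫ m.left) (pullback.snd E.hom g) (by simp [pullback.condition])) p

lemma pullback_map_snd {E E' : Over T} (m : E ⟶ E') (p : (pullback E.hom g).V) :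
    pullback.snd E'.hom g (((Over.pullback g).map m).left p) = pullback.snd E.hom g p :=
  ConcreteCategory.congr_hom (pullback.lift_snd (f := E'.hom) (g := g)
    (pullback.fst E.hom g ≫ m.left) (pullback.snd E.hom g) (by simp [pullback.condition])) p

lemma over_w {E E' : Over T} (m : E ⟶ E') (e : E.left.V) : E'.hom (m.left e) = E.hom e :=
  ConcreteCategory.congr_hom (Over.w m) e

lemma evalAt_comp {E E' : Over T} (m : E ⟶ E') (ε : (Over.pullback g).obj E' ⟶ X) (e : E.left.V)
    (s : S.V) (h : g s = E.hom e) (h') :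
    evalAt ((Over.pullback g).map m ≫ ε) e s h = evalAt ε (m.left e) s h' := by
  refine apply_eq_evalAt ε (((Over.pullback g).map m).left _) _ _ ?_ ?_ h'
  · rw [pullback_map_fst, fst_pullbackPt]
  · rw [pullback_map_snd, snd_pullbackPt]

lemma evalAt_ev (σ : FibreSection g X) (s : S.V) (h : g s = σ.pt) :
    evalAt (E := toOver g X) (ev g X) σ s h = σ.sec ⟨s, h⟩ :=
  ev_apply _ σ s (fst_pullbackPt ..) (snd_pullbackPt ..) h

lemma lift_ev {E : Over T} (ε : (Over.pullback g).obj E ⟶ X) :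
    (Over.pullback g).map (lift ε) ≫ ev g X = ε := by
  ext1
  refine hom_ext_apply fun (p : (pullback E.hom g).V) => ?_
  have h := (pullback_condition_apply E.hom g p).symm
  rw [apply_eq_evalAt _ p _ _ rfl rfl h, apply_eq_evalAt ε p _ _ rfl rfl h,
    evalAt_comp _ _ _ _ _ h]
  exact evalAt_ev ((lift ε).left (pullback.fst E.hom g p)) (pullback.snd E.hom g p) h

lemma lift_unique {E : Over T} (ε : (Over.pullback g).obj E ⟶ X) (m : E ⟶ toOver g X)
    (hm : (Over.pullback g).map m ≫ ev g X = ε) : m = lift ε := by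
  subst hm
  ext1
  refine hom_ext_apply fun e => ext_apply (over_w m e) fun s hs hs' => ?_
  refine (evalAt_ev (m.left e : FibreSection g X) s hs).symm.trans ?_
  exact (evalAt_comp m (ev g X) e s hs' hs).symm

/-- The section `G`-set is terminal among objects over `T` equipped with an evaluation map. -/
noncomputable def isTerminal : IsTerminal (CostructuredArrow.mk (ev g X)) :=
  IsTerminal.ofUniqueHom (fun A => CostructuredArrow.homMk (lift A.hom) (lift_ev A.hom))
    fun A m => by
      ext1
      exact lift_unique _ _ (CostructuredArrow.w m)

end FibreSection

instance (g : S ⟶ T) : (Over.pullback g).IsLeftAdjoint :=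
  have (X : Over S) : HasTerminal (CostructuredArrow (Over.pullback g) X) :=
    FibreSection.isTerminal.hasTerminal
  isLeftAdjoint_of_costructuredArrowTerminals _

/-- The dependent product along `g`, the right adjoint of pullback along `g`. -/
noncomputable def dependentProduct (g : S ⟶ T) : Over S ⥤ Over T :=
  (Over.pullback g).rightAdjoint

/-- The adjunction between pullback and dependent product along `g`. -/
noncomputable def dependentProductAdj (g : S ⟶ T) : Over.pullback g ⊣ dependentProduct g :=
  Adjunction.ofIsLeftAdjoint _

section Evaluation

variable (g : S ⟶ T) (X : Over S)

lemma dependentProduct_exists_iso :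
    ∃ i : (dependentProduct g).obj X ≅ FibreSection.toOver g X,
      (Over.pullback g).map i.hom ≫ FibreSection.ev g X =
        (dependentProductAdj g).counit.app X := by
  let i := (mkTerminalOfRightAdjoint _ (dependentProductAdj g) X).uniqueUpToIso
    (FibreSection.isTerminal (g := g) (X := X))
  exact ⟨(CostructuredArrow.proj _ _).mapIso i, CostructuredArrow.w i.hom⟩

lemma dependentProduct_ext (e e' : ((dependentProduct g).obj X).left.V)
    (h : ((dependentProduct g).obj X).hom e = ((dependentProduct g).obj X).hom e')
    (h' : ∀ s hs hs', FibreSection.evalAt ((dependentProductAdj g).counit.app X) e s hs =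
      FibreSection.evalAt ((dependentProductAdj g).counit.app X) e' s hs') : e = e' := by
  obtain ⟨i, hi⟩ := dependentProduct_exists_iso g X
  have key : i.hom.left e = i.hom.left e' := by
    refine FibreSection.ext_apply (((FibreSection.over_w i.hom e).trans h).trans
      (FibreSection.over_w i.hom e').symm) fun s hs hs' => ?_
    have h₁ := hs.trans (FibreSection.over_w i.hom e)
    have h₂ := hs'.trans (FibreSection.over_w i.hom e')
    have := h' s h₁ h₂
    rw [← hi, FibreSection.evalAt_comp _ _ _ _ _ hs, FibreSection.evalAt_comp _ _ _ _ _ hs'] at this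
    exact ((FibreSection.evalAt_ev _ s hs).symm.trans this).trans (FibreSection.evalAt_ev _ s hs')
  have h₃ := congrArg i.inv.left key
  have h₄ : ∀ x, i.inv.left (i.hom.left x) = x := fun x =>
    ConcreteCategory.congr_hom (congrArg CommaMorphism.left i.hom_inv_id) x
  rwa [h₄, h₄] at h₃

lemma dependentProduct_exists (σ : FibreSection g X) :
    ∃ e : ((dependentProduct g).obj X).left.V, ((dependentProduct g).obj X).hom e = σ.pt ∧
      ∀ s hs hs', FibreSection.evalAt ((dependentProductAdj g).counit.app X) e s hs =
        σ.sec ⟨s, hs'⟩ := by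
  obtain ⟨i, hi⟩ := dependentProduct_exists_iso g X
  have h₄ : i.hom.left (i.inv.left σ) = σ :=
    ConcreteCategory.congr_hom (congrArg CommaMorphism.left i.inv_hom_id) σ
  refine ⟨i.inv.left σ, FibreSection.over_w i.inv σ, fun s hs hs' => ?_⟩
  rw [← hi, FibreSection.evalAt_comp _ _ _ _ _
    (hs.trans (FibreSection.over_w i.hom _).symm)]
  refine (FibreSection.evalAt_ev (i.hom.left (i.inv.left σ) : FibreSection g X) s _).trans ?_
  exact FibreSection.sec_congr h₄ rfl _ _

end Evaluation

end DependentProduct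
end FinGSet

/-- A polynomial `S ← U₁ → U₂ → T` of finite `G`-sets. -/
structure GPoly {G : Type v} [Group G] (S T : FinGSet.{u} G) where
  U₁ : FinGSet.{u} G
  U₂ : FinGSet.{u} G
  /-- The restriction map. -/
  f : U₁ ⟶ S
  /-- The norm map. -/
  g : U₁ ⟶ U₂
  /-- The transfer map. -/
  h : U₂ ⟶ T

namespace GPoly

open FinGSet

variable {G : Type v} [Group G]

/-- An isomorphism of polynomials. -/
structure Iso {S T : FinGSet.{u} G} (P Q : GPoly S T) where
  e₁ : P.U₁ ≅ Q.U₁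
  e₂ : P.U₂ ≅ Q.U₂
  wf : e₁.hom ≫ Q.f = P.f
  wg : e₁.hom ≫ Q.g = P.g ≫ e₂.hom
  wh : e₂.hom ≫ Q.h = P.h

/-- The relation of being isomorphic polynomials. -/
instance isoSetoid (S T : FinGSet.{u} G) : Setoid (GPoly S T) where
  r P Q := Nonempty (Iso P Q)
  iseqv :=
    { refl P := ⟨⟨CategoryTheory.Iso.refl _, CategoryTheory.Iso.refl _, by simp, by simp, by simp⟩⟩
      symm := fun ⟨i⟩ => ⟨⟨i.e₁.symm, i.e₂.symm, by simp [← i.wf],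
        by simp [CategoryTheory.Iso.inv_comp_eq, reassoc_of% i.wg], by simp [← i.wh]⟩⟩
      trans := fun ⟨i⟩ ⟨j⟩ => ⟨⟨i.e₁ ≪≫ j.e₁, i.e₂ ≪≫ j.e₂, by simp [j.wf, i.wf],
        by simp [j.wg, reassoc_of% i.wg], by simp [j.wh, i.wh]⟩⟩ }

/-- The identity polynomial. -/
def id (S : FinGSet.{u} G) : GPoly S S := ⟨S, S, 𝟙 S, 𝟙 S, 𝟙 S⟩

section Comp

variable {S T U : FinGSet.{u} G} (P : GPoly S T) (Q : GPoly T U)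

/-- The base change of the transfer map of `P` along the restriction map of `Q`, as an object over
the source of the norm map of `Q`. -/
noncomputable def baseChange : Over Q.U₁ := Over.mk (pullback.fst Q.f P.h)

/-- The object over `Q.U₂` in the exponential diagram which interchanges the norm map of `Q` with
`baseChange P Q`. -/
noncomputable def prodObj : Over Q.U₂ := (dependentProduct Q.g).obj (baseChange P Q)

/-- The map from the pullback of `prodObj P Q` along `Q.g` to `baseChange P Q`. -/
noncomputable def counit : (Over.pullback Q.g).obj (prodObj P Q) ⟶ baseChange P Q :=
  (dependentProductAdj Q.g).counit.app (baseChange P Q)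

/-- The map along which the norm map of `P` is pulled back. -/
noncomputable def restr : pullback (prodObj P Q).hom Q.g ⟶ P.U₂ :=
  (counit P Q).left ≫ pullback.snd Q.f P.h

/-- The composite `Q ∘ P` of polynomials `S ← P.U₁ → P.U₂ → T` and `T ← Q.U₁ → Q.U₂ → U`:
first the transfer along `P.h` is moved past the restriction along `Q.f` by a pullback square, then
past the norm along `Q.g` by an exponential diagram, and finally the norm along `P.g` is moved past
the resulting restriction by a pullback square. -/
noncomputable def comp : GPoly S U where
  U₁ := pullback P.g (restr P Q)
  U₂ := (prodObj P Q).left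
  f := pullback.fst P.g (restr P Q) ≫ P.f
  g := pullback.snd P.g (restr P Q) ≫ pullback.fst (prodObj P Q).hom Q.g
  h := (prodObj P Q).hom ≫ Q.h

end Comp

/-- A description of a composite in terms of points: the points of `R.U₂` are the sections of
`P.U₂ ×[T] Q.U₁ → Q.U₁` over fibres of `Q.g`, and the points of `R.U₁` are triples consisting of a
point `e` of `R.U₂`, a point in the fibre of `Q.g` at `e`, and a point in the fibre of `P.g` at the
value of the section there. -/
structure CompData {S T U : FinGSet.{u} G} (P : GPoly S T) (Q : GPoly T U) (R : GPoly S U) where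
  d : R.U₂.V → Q.U₂.V
  s : ∀ (e : R.U₂.V) (c : Q.U₁.V), Q.g c = d e → P.U₂.V
  k : R.U₁.V → Q.U₁.V
  a : R.U₁.V → P.U₁.V
  d_smul : ∀ (x : G) e, d (x • e) = (x • d e : Q.U₂.V)
  k_smul : ∀ (x : G) e, k (x • e) = (x • k e : Q.U₁.V)
  a_smul : ∀ (x : G) e, a (x • e) = (x • a e : P.U₁.V)
  s_smul : ∀ (x : G) e c hc hc', s (x • e) (x • c) hc' = (x • s e c hc : P.U₂.V)
  h_s : ∀ e c hc, P.h (s e c hc) = Q.f c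
  h_eq : ∀ e, R.h e = Q.h (d e)
  g_k : ∀ y, Q.g (k y) = d (R.g y)
  g_a : ∀ y, P.g (a y) = s (R.g y) (k y) (g_k y)
  f_eq : ∀ y, R.f y = P.f (a y)
  ext₂ : ∀ e e', d e = d e' → (∀ c hc hc', s e c hc = s e' c hc') → e = e'
  ex₂ : ∀ (d₀ : Q.U₂.V) (s₀ : ∀ c : Q.U₁.V, Q.g c = d₀ → P.U₂.V),
    (∀ c hc, P.h (s₀ c hc) = Q.f c) → ∃ e, d e = d₀ ∧ ∀ c hc hc', s e c hc = s₀ c hc'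
  ext₁ : ∀ y y', R.g y = R.g y' → k y = k y' → a y = a y' → y = y'
  ex₁ : ∀ e c a₀ hc, P.g a₀ = s e c hc → ∃ y, R.g y = e ∧ k y = c ∧ a y = a₀

namespace CompData

lemma s_congr {S T U : FinGSet.{u} G} {P : GPoly S T} {Q : GPoly T U} {R : GPoly S U}
    (D : CompData P Q R) {e e' c c'} (he : e = e') (hc : c = c') (h h') :
    D.s e c h = D.s e' c' h' := by
  subst he hc
  rfl

/-- The points of a composite. -/
noncomputable def ofComp {S T U : FinGSet.{u} G} (P : GPoly S T) (Q : GPoly T U) :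
    CompData P Q (comp P Q) where
  d e := (prodObj P Q).hom e
  s e c hc := pullback.snd Q.f P.h (FibreSection.evalAt (counit P Q) e c hc)
  k y := pullback.snd (prodObj P Q).hom Q.g (pullback.snd P.g (restr P Q) y)
  a y := pullback.fst P.g (restr P Q) y
  d_smul x e := act_map (prodObj P Q).hom x e
  k_smul x e := by
    refine (congrArg _ (act_map _ _ _)).trans (act_map _ _ _)
  a_smul x e := act_map _ _ _
  s_smul x e c hc hc' := (congrArg _ (FibreSection.evalAt_smul _ x e c hc hc')).trans
    (act_map _ _ _)
  h_s e c hc := (pullback_condition_apply Q.f P.h _).symm.trans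
    (congrArg Q.f (FibreSection.hom_evalAt (counit P Q) e c hc))
  h_eq e := rfl
  g_k y := (pullback_condition_apply (prodObj P Q).hom Q.g _).symm
  g_a y := (pullback_condition_apply P.g (restr P Q) y).trans
    (congrArg (pullback.snd Q.f P.h) (FibreSection.apply_eq_evalAt _ _ _ _ rfl rfl _))
  f_eq y := rfl
  ext₂ e e' h h' := by
    refine dependentProduct_ext Q.g (baseChange P Q) e e' h fun s hs hs' => ?_
    refine pullback_ext ?_ (h' s hs hs')
    exact (FibreSection.hom_evalAt (counit P Q) e s hs).trans
      (FibreSection.hom_evalAt (counit P Q) e' s hs').symm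
  ex₂ d₀ s₀ h := by
    obtain ⟨e, he, he'⟩ := dependentProduct_exists Q.g (baseChange P Q)
      ⟨d₀, fun c => pullbackPt Q.f P.h c.1 (s₀ c.1 c.2) (h _ _).symm,
        fun c => fst_pullbackPt ..⟩
    refine ⟨e, he, fun c hc hc' => ?_⟩
    exact (congrArg (pullback.snd Q.f P.h) (he' c hc hc')).trans (snd_pullbackPt _ _ _ _ (h _ _).symm)
  ext₁ y y' h₁ h₂ h₃ := pullback_ext h₃ (pullback_ext h₁ h₂)
  ex₁ e c a₀ hc h := by
    have h' : P.g a₀ = restr P Q (pullbackPt (prodObj P Q).hom Q.g e c hc.symm) :=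
      h
    refine ⟨pullbackPt _ _ _ _ h', ?_, ?_, ?_⟩
    · exact (congrArg (pullback.fst (prodObj P Q).hom Q.g) (snd_pullbackPt ..)).trans
        (fst_pullbackPt ..)
    · exact (congrArg (pullback.snd (prodObj P Q).hom Q.g) (snd_pullbackPt ..)).trans
        (snd_pullbackPt ..)
    · exact fst_pullbackPt ..

/-- Points of a composite only depend on the isomorphism classes of the factors. -/
def transport {S T U : FinGSet.{u} G} {P P' : GPoly S T} {Q Q' : GPoly T U} {R : GPoly S U}
    (i : Iso P P') (j : Iso Q Q') (D : CompData P Q R) : CompData P' Q' R :=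
  have i₁ : ∀ x, i.e₁.inv (i.e₁.hom x) = x := ConcreteCategory.congr_hom i.e₁.hom_inv_id
  have i₁' : ∀ x, i.e₁.hom (i.e₁.inv x) = x := ConcreteCategory.congr_hom i.e₁.inv_hom_id
  have i₂ : ∀ x, i.e₂.inv (i.e₂.hom x) = x := ConcreteCategory.congr_hom i.e₂.hom_inv_id
  have i₂' : ∀ x, i.e₂.hom (i.e₂.inv x) = x := ConcreteCategory.congr_hom i.e₂.inv_hom_id
  have j₁ : ∀ x, j.e₁.inv (j.e₁.hom x) = x := ConcreteCategory.congr_hom j.e₁.hom_inv_id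
  have j₁' : ∀ x, j.e₁.hom (j.e₁.inv x) = x := ConcreteCategory.congr_hom j.e₁.inv_hom_id
  have j₂ : ∀ x, j.e₂.inv (j.e₂.hom x) = x := ConcreteCategory.congr_hom j.e₂.hom_inv_id
  have j₂' : ∀ x, j.e₂.hom (j.e₂.inv x) = x := ConcreteCategory.congr_hom j.e₂.inv_hom_id
  have if' : ∀ x, P'.f (i.e₁.hom x) = P.f x := ConcreteCategory.congr_hom i.wf
  have ig : ∀ x, P'.g (i.e₁.hom x) = i.e₂.hom (P.g x) := ConcreteCategory.congr_hom i.wg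
  have ih : ∀ x, P'.h (i.e₂.hom x) = P.h x := ConcreteCategory.congr_hom i.wh
  have jf : ∀ x, Q'.f (j.e₁.hom x) = Q.f x := ConcreteCategory.congr_hom j.wf
  have jg : ∀ x, Q'.g (j.e₁.hom x) = j.e₂.hom (Q.g x) := ConcreteCategory.congr_hom j.wg
  have jh : ∀ x, Q'.h (j.e₂.hom x) = Q.h x := ConcreteCategory.congr_hom j.wh
  have key : ∀ c d, Q'.g c = j.e₂.hom d → Q.g (j.e₁.inv c) = d := fun c d h => by
    have := jg (j.e₁.inv c)
    rw [j₁', h] at this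
    rw [← j₂ d, this, j₂]
  { d e := j.e₂.hom (D.d e)
    s e c hc := i.e₂.hom (D.s e (j.e₁.inv c) (key _ _ hc))
    k y := j.e₁.hom (D.k y)
    a y := i.e₁.hom (D.a y)
    d_smul x e := by rw [D.d_smul, act_map]
    k_smul x e := by rw [D.k_smul, act_map]
    a_smul x e := by rw [D.a_smul, act_map]
    s_smul x e c hc hc' := by
      rw [← act_map, ← D.s_smul]
      · exact congrArg _ (D.s_congr rfl (act_map _ _ _) _ _)
      · rw [← act_map]
        exact key _ _ hc'
    h_s e c hc := by rw [ih, D.h_s, ← jf, j₁']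
    h_eq e := by rw [jh, D.h_eq]
    g_k y := by rw [jg, D.g_k]
    g_a y := by
      rw [ig, D.g_a]
      exact congrArg _ (D.s_congr rfl (j₁ _).symm _ _)
    f_eq y := by rw [if', D.f_eq]
    ext₂ e e' h h' := by
      have hd : D.d e = D.d e' := by rw [← j₂ (D.d e), h, j₂]
      refine D.ext₂ e e' hd fun c hc hc' => ?_
      have := h' (j.e₁.hom c) (by rw [jg, hc]) (by rw [jg, hc'])
      have h₂ := congrArg i.e₂.inv this
      rw [i₂, i₂] at h₂
      exact (D.s_congr rfl (j₁ c).symm _ _).trans (h₂.trans (D.s_congr rfl (j₁ c) _ _))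
    ex₂ d₀ s₀ h := by
      obtain ⟨e, he, he'⟩ := D.ex₂ (j.e₂.inv d₀)
        (fun c hc => i.e₂.inv (s₀ (j.e₁.hom c) (by rw [jg, hc, j₂'])))
        (fun c hc => by rw [← ih, i₂', h, jf])
      refine ⟨e, by rw [he, j₂'], fun c hc hc' => ?_⟩
      rw [he' _ _ (by rw [← he]; exact key _ _ hc), i₂']
      congr 1
      exact j₁' c
    ext₁ y y' h₁ h₂ h₃ :=
      D.ext₁ y y' h₁ (by rw [← j₁ (D.k y), h₂, j₁]) (by rw [← i₁ (D.a y), h₃, i₁])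
    ex₁ e c a₀ hc h := by
      obtain ⟨y, h₁, h₂, h₃⟩ := D.ex₁ e (j.e₁.inv c) (i.e₁.inv a₀) (key _ _ hc) (by
        rw [← i₂ (P.g _), ← ig, i₁', h, i₂])
      exact ⟨y, h₁, by rw [h₂, j₁'], by rw [h₃, i₁']⟩ }

/-- The points of an iterated composite. -/
noncomputable def assoc {S T U V : FinGSet.{u} G} {P : GPoly S T} {Q : GPoly T U} {W : GPoly U V}
    {PQ : GPoly S U} {QW : GPoly T V} {X : GPoly S V}
    (A : CompData P Q PQ) (B : CompData Q W QW) (C : CompData PQ W X) : CompData P QW X :=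
  have E₂ : ∀ e, ∃ d, B.d d = C.d e ∧ ∀ c hc hc', B.s d c hc = A.d (C.s e c hc') := fun e =>
    B.ex₂ (C.d e) (fun c hc => A.d (C.s e c hc)) fun c hc => by rw [← A.h_eq, C.h_s]
  let d := fun e => (E₂ e).choose
  have d₁ : ∀ e, B.d (d e) = C.d e := fun e => (E₂ e).choose_spec.1
  have d₂ : ∀ e c hc hc', B.s (d e) c hc = A.d (C.s e c hc') := fun e => (E₂ e).choose_spec.2
  have E₁ : ∀ y, ∃ z, QW.g z = d (X.g y) ∧ B.k z = C.k y ∧ B.a z = A.k (C.a y) := fun y =>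
    B.ex₁ _ _ _ (by rw [C.g_k, d₁]) (by rw [d₂ _ _ _ (C.g_k y), A.g_k, C.g_a])
  let k := fun y => (E₁ y).choose
  have k₁ : ∀ y, QW.g (k y) = d (X.g y) := fun y => (E₁ y).choose_spec.1
  have k₂ : ∀ y, B.k (k y) = C.k y := fun y => (E₁ y).choose_spec.2.1
  have k₃ : ∀ y, B.a (k y) = A.k (C.a y) := fun y => (E₁ y).choose_spec.2.2
  have hk : ∀ e z, QW.g z = d e → W.g (B.k z) = C.d e := fun e z hz => by rw [B.g_k, hz, d₁]
  have ha : ∀ e z hz, Q.g (B.a z) = A.d (C.s e (B.k z) (hk e z hz)) := fun e z hz => by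
    rw [B.g_a, B.s_congr hz rfl _ (by rw [hk e z hz, d₁])]
    exact d₂ ..
  have d_smul : ∀ (x : G) e, d (x • e) = (x • d e : QW.U₂.V) := fun x e => by
    have h₀ : B.d (d (x • e)) = B.d (x • d e) := by rw [d₁, C.d_smul, B.d_smul, d₁]
    refine B.ext₂ _ _ h₀ fun c hc hc' => ?_
    obtain ⟨c, rfl⟩ : ∃ c' : W.U₁.V, c = x • c' := ⟨x⁻¹ • c, (smul_inv_smul x c).symm⟩
    have h₁ : W.g c = B.d (d e) := by
      rwa [B.d_smul, act_map, smul_left_cancel_iff] at hc'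
    have h₂ : W.g c = C.d e := h₁.trans (d₁ e)
    rw [B.s_smul x _ c h₁, d₂ _ _ _ h₂, ← A.d_smul, ← C.s_smul x e c h₂ (by
      rw [hc, d₁])]
    exact d₂ ..
  { d := d
    s e z hz := A.s (C.s e (B.k z) (hk e z hz)) (B.a z) (ha e z hz)
    k := k
    a y := A.a (C.a y)
    d_smul := d_smul
    k_smul x y := B.ext₁ _ _
      (by rw [k₁, act_map, act_map, k₁, d_smul])
      (by rw [k₂, B.k_smul, k₂, C.k_smul])
      (by rw [k₃, B.a_smul, k₃, C.a_smul, A.k_smul])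
    a_smul x e := by rw [C.a_smul, A.a_smul]
    s_smul x e c hc hc' := by
      rw [← A.s_smul x _ _ (ha e c hc) (by rw [act_map, A.d_smul, ha e c hc])]
      · refine A.s_congr ?_ (B.a_smul _ _) _ _
        rw [← C.s_smul x e _ (hk e c hc) (by rw [act_map, C.d_smul, hk e c hc])]
        exact C.s_congr rfl (B.k_smul _ _) _ _
    h_s e c hc := by rw [A.h_s, B.f_eq]
    h_eq e := by rw [C.h_eq, B.h_eq, d₁]
    g_k := k₁
    g_a y := by
      rw [A.g_a]
      exact A.s_congr ((C.g_a y).trans (C.s_congr rfl (k₂ y).symm _ _)) (k₃ y).symm _ _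
    f_eq y := by rw [C.f_eq, A.f_eq]
    ext₂ e e' h h' := by
      have h₀ : C.d e = C.d e' := by rw [← d₁, h, d₁]
      refine C.ext₂ _ _ h₀ fun c hc hc' => ?_
      have hB : W.g c = B.d (d e) := by rw [hc, d₁]
      have hB' : W.g c = B.d (d e') := by rw [hc', d₁]
      have h₁ : A.d (C.s e c hc) = A.d (C.s e' c hc') := by
        rw [← d₂ _ _ hB, ← d₂ _ _ hB']
        exact B.s_congr h rfl _ _
      refine A.ext₂ _ _ h₁ fun q hq hq' => ?_
      obtain ⟨z, hz₁, rfl, rfl⟩ := B.ex₁ (d e) c q hB (by rw [hq, d₂])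
      exact h' z hz₁ (hz₁.trans h)
    ex₂ d₀ s₀ h := by
      have Z : ∀ c hc q, Q.g q = B.s d₀ c hc → ∃ z, QW.g z = d₀ ∧ B.k z = c ∧ B.a z = q :=
        fun c hc q hq => B.ex₁ _ _ _ hc hq
      choose z z₁ z₂ z₃ using Z
      have Y := fun c hc => A.ex₂ (B.s d₀ c hc) (fun q hq => s₀ (z c hc q hq) (z₁ c hc q hq))
        fun q hq => by rw [h, B.f_eq, z₃]
      choose y y₁ y₂ using Y
      obtain ⟨e, he, he'⟩ := C.ex₂ (B.d d₀) y fun c hc => by rw [A.h_eq, y₁, B.h_s]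
      have hd : d e = d₀ := B.ext₂ _ _ (by rw [d₁, he]) fun c hc hc' => by
        rw [d₂ _ _ _ (by rw [hc', he]), he' _ _ hc', y₁]
      refine ⟨e, hd, fun c hc hc' => ?_⟩
      have hc₁ : W.g (B.k c) = B.d d₀ := by rw [B.g_k, hc']
      have hc₂ : Q.g (B.a c) = B.s d₀ (B.k c) hc₁ := by
        rw [B.g_a]
        exact B.s_congr hc' rfl _ _
      rw [A.s_congr (he' _ _ hc₁) rfl _ (by rw [y₁, hc₂]), y₂ _ _ _ _ hc₂]
      congr 1
      exact B.ext₁ _ _ (by rw [z₁, hc']) (z₂ ..) (z₃ ..)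
    ext₁ y y' h₁ h₂ h₃ := C.ext₁ _ _ h₁ (by rw [← k₂, h₂, k₂]) (A.ext₁ _ _
      (by
        rw [C.g_a, C.g_a]
        exact C.s_congr h₁ (by rw [← k₂, h₂, k₂]) _ _)
      (by rw [← k₃, h₂, k₃]) h₃)
    ex₁ e c a₀ hc h := by
      obtain ⟨y, hy₁, hy₂, hy₃⟩ := A.ex₁ _ _ _ (ha e c hc) h
      obtain ⟨x, hx₁, hx₂, hx₃⟩ := C.ex₁ _ _ _ (hk e c hc) hy₁
      exact ⟨x, hx₁, B.ext₁ _ _ (by rw [k₁, hx₁, hc]) (by rw [k₂, hx₂]) (by rw [k₃, hx₃, hy₂]),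
        by rw [hx₃, hy₃]⟩ }

/-- The points of a composite with an identity polynomial. -/
def idLeft {S T : FinGSet.{u} G} (Q : GPoly S T) : CompData (GPoly.id S) Q Q where
  d e := e
  s _ c _ := Q.f c
  k y := y
  a y := Q.f y
  d_smul _ _ := rfl
  k_smul _ _ := rfl
  a_smul _ _ := act_map _ _ _
  s_smul _ _ _ _ _ := act_map _ _ _
  h_s _ _ _ := rfl
  h_eq _ := rfl
  g_k _ := rfl
  g_a _ := rfl
  f_eq _ := rfl
  ext₂ _ _ h _ := h
  ex₂ d₀ _ h := ⟨d₀, rfl, fun c _ hc' => (h c hc').symm⟩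
  ext₁ _ _ _ h _ := h
  ex₁ _ c _ hc h := ⟨c, hc, rfl, h.symm⟩

/-- The points of a composite with an identity polynomial. -/
def idRight {S T : FinGSet.{u} G} (P : GPoly S T) : CompData P (GPoly.id T) P where
  d e := P.h e
  s e _ _ := e
  k y := P.h (P.g y)
  a y := y
  d_smul _ _ := act_map _ _ _
  k_smul _ _ := (congrArg _ (act_map _ _ _)).trans (act_map _ _ _)
  a_smul _ _ := rfl
  s_smul _ _ _ _ _ := rfl
  h_s _ _ hc := hc.symm
  h_eq _ := rfl
  g_k _ := rfl
  g_a _ := rfl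
  f_eq _ := rfl
  ext₂ e e' h h' := h' (P.h e) rfl h
  ex₂ d₀ s₀ h := ⟨s₀ d₀ rfl, h d₀ rfl, fun c _ hc' => by
    obtain rfl : c = d₀ := hc'
    rfl⟩
  ext₁ _ _ _ _ h := h
  ex₁ e c a₀ hc h := ⟨a₀, h, (congrArg P.h h).trans hc.symm, rfl⟩

end CompData

lemma equiv_of_rel {S T : FinGSet.{u} G} {P Q : GPoly S T}
    (r₁ : P.U₁.V → Q.U₁.V → Prop) (r₂ : P.U₂.V → Q.U₂.V → Prop)
    (s₁ : ∀ (a : G) x y, r₁ x y → r₁ (a • x : P.U₁.V) (a • y : Q.U₁.V))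
    (s₂ : ∀ (a : G) x y, r₂ x y → r₂ (a • x : P.U₂.V) (a • y : Q.U₂.V))
    (e₁ : ∀ x, ∃ y, r₁ x y) (e₂ : ∀ x, ∃ y, r₂ x y)
    (e₁' : ∀ y, ∃ x, r₁ x y) (e₂' : ∀ y, ∃ x, r₂ x y)
    (u₁ : ∀ x y y', r₁ x y → r₁ x y' → y = y') (u₂ : ∀ x y y', r₂ x y → r₂ x y' → y = y')
    (u₁' : ∀ x x' y, r₁ x y → r₁ x' y → x = x') (u₂' : ∀ x x' y, r₂ x y → r₂ x' y → x = x')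
    (wf : ∀ x y, r₁ x y → Q.f y = P.f x) (wg : ∀ x y, r₁ x y → r₂ (P.g x) (Q.g y))
    (wh : ∀ x y, r₂ x y → Q.h y = P.h x) : P ≈ Q := by
  obtain ⟨i₁, h₁⟩ := exists_iso r₁ s₁ e₁ e₁' u₁ u₁'
  obtain ⟨i₂, h₂⟩ := exists_iso r₂ s₂ e₂ e₂' u₂ u₂'
  exact ⟨⟨i₁, i₂, hom_ext_apply fun x => wf _ _ (h₁ x),
    hom_ext_apply fun x => u₂ _ _ _ (wg _ _ (h₁ x)) (h₂ _),
    hom_ext_apply fun x => wh _ _ (h₂ x)⟩⟩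

lemma CompData.unique {S T U : FinGSet.{u} G} {P : GPoly S T} {Q : GPoly T U} {R R' : GPoly S U}
    (D : CompData P Q R) (D' : CompData P Q R') : R ≈ R' := by
  let r₂ : R.U₂.V → R'.U₂.V → Prop := fun e e' =>
    D.d e = D'.d e' ∧ ∀ c hc hc', D.s e c hc = D'.s e' c hc'
  have s₂ : ∀ (a : G) x y, r₂ x y → r₂ (a • x : R.U₂.V) (a • y : R'.U₂.V) := by
    rintro a e e' ⟨h, h'⟩
    refine ⟨by rw [D.d_smul, D'.d_smul, h], fun c hc hc' => ?_⟩
    obtain ⟨c, rfl⟩ : ∃ c' : Q.U₁.V, c = a • c' := ⟨a⁻¹ • c, (smul_inv_smul a c).symm⟩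
    have h₁ : Q.g c = D.d e := by rwa [D.d_smul, act_map, smul_left_cancel_iff] at hc
    have h₂ : Q.g c = D'.d e' := h₁.trans h
    rw [D.s_smul a e c h₁, D'.s_smul a e' c h₂, h' c h₁ h₂]
  refine equiv_of_rel (fun y y' => r₂ (R.g y) (R'.g y') ∧ D.k y = D'.k y' ∧ D.a y = D'.a y') r₂
    ?_ s₂ ?_ ?_ ?_ ?_ ?_ ?_ ?_ ?_ ?_ ?_ ?_
  · rintro a y y' ⟨h₁, h₂, h₃⟩
    refine ⟨?_, by rw [D.k_smul, D'.k_smul, h₂], by rw [D.a_smul, D'.a_smul, h₃]⟩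
    rw [act_map, act_map]
    exact s₂ _ _ _ h₁
  · intro y
    obtain ⟨e, h₁, h₂⟩ := D'.ex₂ (D.d (R.g y)) (D.s (R.g y)) (D.h_s _)
    have hk : Q.g (D.k y) = D'.d e := (D.g_k y).trans h₁.symm
    obtain ⟨y', rfl, h₃, h₄⟩ := D'.ex₁ e (D.k y) (D.a y) hk
      ((D.g_a y).trans (h₂ _ _ _).symm)
    exact ⟨y', ⟨h₁.symm, fun c hc hc' => (h₂ c hc' hc).symm⟩, h₃.symm, h₄.symm⟩
  · intro e
    obtain ⟨e, h₁, h₂⟩ := D'.ex₂ (D.d e) (D.s e) (D.h_s _)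
    exact ⟨e, h₁.symm, fun c hc hc' => (h₂ c hc' hc).symm⟩
  · intro y
    obtain ⟨e, h₁, h₂⟩ := D.ex₂ (D'.d (R'.g y)) (D'.s (R'.g y)) (D'.h_s _)
    have hk : Q.g (D'.k y) = D.d e := (D'.g_k y).trans h₁.symm
    obtain ⟨y', rfl, h₃, h₄⟩ := D.ex₁ e (D'.k y) (D'.a y) hk
      ((D'.g_a y).trans (h₂ _ _ _).symm)
    exact ⟨y', ⟨h₁, fun c hc hc' => h₂ c hc hc'⟩, h₃, h₄⟩
  · intro e
    obtain ⟨e, h₁, h₂⟩ := D.ex₂ (D'.d e) (D'.s e) (D'.h_s _)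
    exact ⟨e, h₁, fun c hc hc' => h₂ c hc hc'⟩
  · rintro x y y' ⟨⟨h₁, h₂⟩, h₃, h₄⟩ ⟨⟨h₁', h₂'⟩, h₃', h₄'⟩
    exact D'.ext₁ _ _ (D'.ext₂ _ _ (h₁.symm.trans h₁') fun c hc hc' =>
      (h₂ c (hc.trans h₁.symm) hc).symm.trans (h₂' _ _ _)) (h₃.symm.trans h₃') (h₄.symm.trans h₄')
  · rintro x y y' ⟨h₁, h₂⟩ ⟨h₁', h₂'⟩
    exact D'.ext₂ _ _ (h₁.symm.trans h₁') fun c hc hc' =>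
      (h₂ c (hc.trans h₁.symm) hc).symm.trans (h₂' _ _ _)
  · rintro x x' y ⟨⟨h₁, h₂⟩, h₃, h₄⟩ ⟨⟨h₁', h₂'⟩, h₃', h₄'⟩
    exact D.ext₁ _ _ (D.ext₂ _ _ (h₁.trans h₁'.symm) fun c hc hc' =>
      (h₂ c hc (hc.trans h₁)).trans (h₂' _ _ _).symm) (h₃.trans h₃'.symm) (h₄.trans h₄'.symm)
  · rintro x x' y ⟨h₁, h₂⟩ ⟨h₁', h₂'⟩
    exact D.ext₂ _ _ (h₁.trans h₁'.symm) fun c hc hc' =>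
      (h₂ c hc (hc.trans h₁)).trans (h₂' _ _ _).symm
  · rintro y y' ⟨-, -, h⟩
    rw [D.f_eq, D'.f_eq, h]
  · rintro y y' ⟨h, -⟩
    exact h
  · rintro e e' ⟨h, -⟩
    rw [D.h_eq, D'.h_eq, h]

lemma comp_congr {S T U : FinGSet.{u} G} {P P' : GPoly S T} {Q Q' : GPoly T U} (hP : P ≈ P')
    (hQ : Q ≈ Q') : comp P Q ≈ comp P' Q' := by
  obtain ⟨i⟩ := hP
  obtain ⟨j⟩ := hQ
  exact ((CompData.ofComp P Q).transport i j).unique (CompData.ofComp P' Q')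

lemma comp_assoc {S T U V : FinGSet.{u} G} (P : GPoly S T) (Q : GPoly T U) (W : GPoly U V) :
    comp (comp P Q) W ≈ comp P (comp Q W) :=
  ((CompData.ofComp P Q).assoc (CompData.ofComp Q W) (CompData.ofComp _ W)).unique
    (CompData.ofComp _ _)

end GPoly

/-- The category of polynomials: the objects are the finite `G`-sets. -/
structure PolyCat (G : Type v) [Group G] where
  of ::
  /-- The underlying finite `G`-set. -/
  obj : FinGSet.{u} G

namespace PolyCat

variable {G : Type v} [Group G]

/-- Morphisms are isomorphism classes of polynomials. -/
noncomputable instance : Category (PolyCat.{u} G) where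
  Hom S T := Quotient (GPoly.isoSetoid S.obj T.obj)
  id S := Quotient.mk _ (GPoly.id S.obj)
  comp p q := Quotient.map₂ GPoly.comp (fun _ _ h _ _ h' => GPoly.comp_congr h h') p q
  id_comp p := by
    induction p using Quotient.inductionOn with | _ p =>
    exact Quotient.sound ((GPoly.CompData.ofComp _ _).unique (GPoly.CompData.idLeft p))
  comp_id p := by
    induction p using Quotient.inductionOn with | _ p =>
    exact Quotient.sound ((GPoly.CompData.ofComp _ _).unique (GPoly.CompData.idRight p))
  assoc p q r := by
    induction p using Quotient.inductionOn with | _ p =>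
    induction q using Quotient.inductionOn with | _ q =>
    induction r using Quotient.inductionOn with | _ r =>
    exact Quotient.sound (GPoly.comp_assoc p q r)

/-- The morphism represented by a polynomial. -/
def mk {S T : PolyCat.{u} G} (p : GPoly S.obj T.obj) : S ⟶ T :=
  Quotient.mk (GPoly.isoSetoid S.obj T.obj) p

end PolyCat

/-- An indexing category: a class of maps of finite `G`-sets which contains the identities and is
closed under composition (a wide subcategory), is stable under pullback, and such that the
corresponding wide subcategory has finite coproducts, which are coproducts of finite `G`-sets. -/
class IsIndexingCategory {G : Type v} [Group G] (O : MorphismProperty (FinGSet.{u} G)) : Prop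
    extends O.IsMultiplicative, O.IsStableUnderBaseChange where
  hasFiniteCoproducts : HasFiniteCoproducts (WideSubcategory O)
  preservesFiniteCoproducts : PreservesFiniteCoproducts (wideSubcategoryInclusion O)

/-- `(Oa, Om)` is compatible: the dependent product along a map `g : S ⟶ T` in `Om` takes maps
`X ⟶ S` in `Oa` to maps in `Oa`. -/
def IsCompatible {G : Type v} [Group G] (Oa Om : MorphismProperty (FinGSet.{u} G)) : Prop :=
  ∀ ⦃S T : FinGSet.{u} G⦄ (g : S ⟶ T), Om g → ∀ X : Over S, Oa X.hom →
    Oa ((FinGSet.dependentProduct g).obj X).hom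

/-- The wide subgraph of the category of polynomials whose arrows are the isomorphism classes of
polynomials with norm map in `Om` and transfer map in `Oa`. -/
def polySubgraph {G : Type v} [Group G] (Oa Om : MorphismProperty (FinGSet.{u} G)) :
    MorphismProperty (PolyCat.{u} G) :=
  fun S T φ => ∃ p : GPoly S.obj T.obj, PolyCat.mk p = φ ∧ Om p.g ∧ Oa p.h

/-!
The norm map of a composite `Q ∘ P` is a base change of the norm map of `P` followed by a base
change of the norm map of `Q`. Its transfer map is the dependent product, along the norm map of `Q`,
of a base change of the transfer map of `P`, followed by the transfer map of `Q`; compatibility is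
exactly what keeps that dependent product in `Oa`.
-/

namespace GPoly

variable {G : Type v} [Group G] {Oa Om : MorphismProperty (FinGSet.{u} G)} {S T U : FinGSet.{u} G}

lemma Iso.norm_mem_iff [Om.RespectsIso] {P Q : GPoly S T} (i : Iso P Q) : Om P.g ↔ Om Q.g :=
  Om.arrow_mk_iso_iff (Arrow.isoMk i.e₁ i.e₂ i.wg)

lemma Iso.transfer_mem_iff [Oa.RespectsIso] {P Q : GPoly S T} (i : Iso P Q) : Oa P.h ↔ Oa Q.h := by
  rw [← i.wh, Oa.cancel_left_of_respectsIso]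

lemma comp_norm_mem [Om.IsStableUnderComposition] [Om.IsStableUnderBaseChange]
    {P : GPoly S T} {Q : GPoly T U} (hP : Om P.g) (hQ : Om Q.g) : Om (comp P Q).g :=
  Om.comp_mem _ _ (Om.pullback_snd P.g (restr P Q) hP) (Om.pullback_fst (prodObj P Q).hom Q.g hQ)

lemma comp_transfer_mem [Oa.IsStableUnderComposition] [Oa.IsStableUnderBaseChange]
    (hcompat : IsCompatible Oa Om) {P : GPoly S T} {Q : GPoly T U}
    (hP : Oa P.h) (hQg : Om Q.g) (hQh : Oa Q.h) : Oa (comp P Q).h :=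
  have baseChange_mem : Oa (baseChange P Q).hom := Oa.pullback_fst Q.f P.h hP
  have prodObj_mem : Oa (prodObj P Q).hom := hcompat Q.g hQg (baseChange P Q) baseChange_mem
  Oa.comp_mem _ _ prodObj_mem hQh

end GPoly

section PolySubgraph

variable {G : Type v} [Group G] {Oa Om : MorphismProperty (FinGSet.{u} G)}

lemma polySubgraph_mk_iff [Oa.RespectsIso] [Om.RespectsIso] {S T : PolyCat.{u} G}
    (p : GPoly S.obj T.obj) : polySubgraph Oa Om (PolyCat.mk p) ↔ Om p.g ∧ Oa p.h := by
  refine ⟨?_, fun h => ⟨p, rfl, h⟩⟩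
  rintro ⟨q, hqp, hq⟩
  obtain ⟨i⟩ : Nonempty (GPoly.Iso q p) := Quotient.exact hqp
  exact hq.imp i.norm_mem_iff.1 i.transfer_mem_iff.1

variable [Oa.IsMultiplicative] [Om.IsMultiplicative] [Oa.IsStableUnderBaseChange]
  [Om.IsStableUnderBaseChange]

lemma polySubgraph_isMultiplicative (hcompat : IsCompatible Oa Om) :
    (polySubgraph Oa Om).IsMultiplicative where
  id_mem S := ⟨GPoly.id S.obj, rfl, Om.id_mem _, Oa.id_mem _⟩
  comp_mem := by
    rintro S T U _ _ ⟨p, rfl, hpg, hph⟩ ⟨q, rfl, hqg, hqh⟩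
    exact ⟨GPoly.comp p q, rfl, GPoly.comp_norm_mem hpg hqg,
      GPoly.comp_transfer_mem hcompat hph hqg hqh⟩

theorem mainTheorem1_general (hcompat : IsCompatible Oa Om) :
    (polySubgraph Oa Om).IsMultiplicative ∧
      ∀ (S T : PolyCat.{u} G) (p : GPoly S.obj T.obj),
        polySubgraph Oa Om (PolyCat.mk p) ↔ Om p.g ∧ Oa p.h :=
  ⟨polySubgraph_isMultiplicative hcompat, fun _ _ => polySubgraph_mk_iff⟩

end PolySubgraph

theorem mainTheorem1 {G : Type v} [Group G] [Finite G] (Oa Om : MorphismProperty (FinGSet.{u} G))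
    [IsIndexingCategory Oa] [IsIndexingCategory Om] (hcompat : IsCompatible Oa Om) :
    (polySubgraph Oa Om).IsMultiplicative ∧
      ∀ (S T : PolyCat.{u} G) (p : GPoly S.obj T.obj),
        polySubgraph Oa Om (PolyCat.mk p) ↔ Om p.g ∧ Oa p.h :=
  mainTheorem1_general hcompat
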